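/- Let $p\ge 1$ and $n\ge 2$, and let ${\bf x}_1,\dots,{\bf x}_n$ be an i.i.d. sample from a $p$-variate elliptical distribution with finite fourth order moments, mean vector $\boldsymbol\mu$ and positive definite covariance matrix ${\bf M}$; that is, the distribution has Lebesgue density $f({\bf x})=C\,|{\bf M}|^{-1/2}g\big(({\bf x}-\boldsymbol\mu)^\top{\bf M}^{-1}({\bf x}-\boldsymbol\mu)\big)$ for some function $g:[0,\infty)\to[0,\infty)$ and normalizing constant $C>0$, where $g$ is scaled so that ${\bf M}$ is the covariance matrix. Let $\bar{\bf x}=\frac1n\sum_{i=1}^n{\bf x}_i$ and ${\bf S}=\frac1{n-1}\sum_{i=1}^n({\bf x}_i-\bar{\bf x})({\bf x}_i-\bar{\bf x})^\top$, and for real $\alpha,\beta$ put ${\bf S}_{\alpha,\beta}=\beta{\bf S}+\alpha{\bf I}$ and $\mathrm{MSE}(\alpha,\beta)=\mathbb E\big[\|{\bf S}_{\alpha,\beta}-{\bf M}\|_{\mathrm F}^2\big]$, where $\|\cdot\|_{\mathrm F}$ is the Frobenius norm. Let $$\eta=\frac{\mathrm{tr}({\bf M})}{p},\qquad \gamma=\frac{p\,\mathrm{tr}({\bf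 M}^2)}{\mathrm{tr}({\bf M})^2},\qquad \kappa=\frac{\mathbb E[r^4]}{p(p+2)}-1,\quad r^2=({\bf x}_1-\boldsymbol\mu)^\top{\bf M}^{-1}({\bf x}_1-\boldsymbol\mu),$$ be the scale, the sphericity and the elliptical kurtosis. Then $\mathbb E[r^4]$ and all the $\mathrm{MSE}(\alpha,\beta)$ are finite, the denominator below is positive, and, with $$\beta_o=\frac{\gamma-1}{(\gamma-1)+\kappa(2\gamma+p)/n+(\gamma+p)/(n-1)},\qquad \alpha_o=(1-\beta_o)\eta,$$ one has $\alpha_o>0$ and $0\le\beta_o<1$, and $(\alpha_o,\beta_o)$ is the unique minimizer of $\mathrm{MSE}(\alpha,\beta)$ over all real pairs $(\alpha,\beta)$ and over all pairs with $\alpha,\beta\ge 0$; if $\gamma\neq1$ (that is, if ${\bf M}$ is not a multiple of the identity), it is also the unique minimizer over all pairs with $\alpha,\beta>0$. -/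

import Mathlib

open MeasureTheory ProbabilityTheory Matrix

noncomputable section

namespace EllShrink

/-- The quadratic form `r² = (x - μ)ᵀ M⁻¹ (x - μ)`, the square of the generating variate. -/
def quadForm {p : ℕ} (μ : Fin p → ℝ) (M : Matrix (Fin p) (Fin p) ℝ) (x : Fin p → ℝ) : ℝ :=
  (x - μ) ⬝ᵥ (M⁻¹ *ᵥ (x - μ))

/-- `P` is the elliptical distribution on `ℝᵖ` with mean vector `μ`, positive definite covariance
matrix `M` and density generator `g : [0, ∞) → [0, ∞)`: it is a probability measure with Lebesgue
density `C |M|^{-1/2} g((x - μ)ᵀ M⁻¹ (x - μ))`, where the normalizing constant `C` is determined by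
total mass one and `g` is scaled so that `M` is the covariance matrix.
Values of `g` at negative arguments are irrelevant. -/
structure IsElliptical {p : ℕ} (P : Measure (Fin p → ℝ)) (μ : Fin p → ℝ)
    (M : Matrix (Fin p) (Fin p) ℝ) (g : ℝ → ℝ) : Prop where
  posDef : M.PosDef
  measurable_generator : Measurable g
  generator_nonneg : ∀ t, 0 ≤ t → 0 ≤ g t
  isProbabilityMeasure : IsProbabilityMeasure P
  density : ∃ C : ℝ, 0 < C ∧ P = (volume : Measure (Fin p → ℝ)).withDensity
    (fun x => ENNReal.ofReal (C * (Real.sqrt M.det)⁻¹ * g (quadForm μ M x)))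
  memLp_two : ∀ i, MemLp (fun x : Fin p → ℝ => x i) 2 P
  mean_eq : ∀ i, ∫ x, x i ∂P = μ i
  covariance_eq : ∀ i j, ∫ x, (x i - μ i) * (x j - μ j) ∂P = M i j

/-- Finite fourth order moments. -/
def HasFiniteFourthMoments {p : ℕ} (P : Measure (Fin p → ℝ)) : Prop :=
  ∀ i, MemLp (fun x : Fin p → ℝ => x i) 4 P

/-- The elliptical kurtosis parameter `κ = E[r⁴] / (p (p + 2)) - 1`. -/
def ellipticalKurtosis {p : ℕ} (P : Measure (Fin p → ℝ)) (μ : Fin p → ℝ)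
    (M : Matrix (Fin p) (Fin p) ℝ) : ℝ :=
  (∫ x, (quadForm μ M x) ^ 2 ∂P) / ((p : ℝ) * ((p : ℝ) + 2)) - 1

/-- The scale `η = tr(M) / p`. -/
def scale {p : ℕ} (M : Matrix (Fin p) (Fin p) ℝ) : ℝ := M.trace / (p : ℝ)

/-- The sphericity `γ = p tr(M²) / tr(M)²`. -/
def sphericity {p : ℕ} (M : Matrix (Fin p) (Fin p) ℝ) : ℝ :=
  (p : ℝ) * (M * M).trace / M.trace ^ 2

/-- The sample mean vector of `x₁, …, xₙ`. -/
def sampleMean {n p : ℕ} (x : Fin n → Fin p → ℝ) : Fin p → ℝ :=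
  (n : ℝ)⁻¹ • ∑ i, x i

/-- The sample covariance matrix `S = (n - 1)⁻¹ ∑ᵢ (xᵢ - x̄)(xᵢ - x̄)ᵀ`. -/
def sampleCov {n p : ℕ} (x : Fin n → Fin p → ℝ) : Matrix (Fin p) (Fin p) ℝ :=
  ((n : ℝ) - 1)⁻¹ • ∑ i, vecMulVec (x i - sampleMean x) (x i - sampleMean x)

/-- The regularized sample covariance matrix `S_{α,β} = β S + α I`. -/
def rscm {n p : ℕ} (α β : ℝ) (x : Fin n → Fin p → ℝ) : Matrix (Fin p) (Fin p) ℝ :=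
  β • sampleCov x + α • (1 : Matrix (Fin p) (Fin p) ℝ)

/-- The squared Frobenius norm `‖A‖_F² = tr(Aᵀ A)`. -/
def frobSq {p : ℕ} (A : Matrix (Fin p) (Fin p) ℝ) : ℝ := (Aᵀ * A).trace

/-- The mean squared error `E[‖S_{α,β} - M‖_F²]`, for the sample `x` on the probability
space `(Ω, Pr)`, at the pair `q = (α, β)`. -/
def rscmMSE {Ω : Type*} [MeasurableSpace Ω] (Pr : Measure Ω) {n p : ℕ}
    (x : Fin n → Ω → Fin p → ℝ) (M : Matrix (Fin p) (Fin p) ℝ) (q : ℝ × ℝ) : ℝ :=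
  ∫ ω, frobSq (rscm q.1 q.2 (fun i => x i ω) - M) ∂Pr

/-- The set of all minimizers of `f` over `D`. -/
def argminOn (f : ℝ × ℝ → ℝ) (D : Set (ℝ × ℝ)) : Set (ℝ × ℝ) :=
  {q | q ∈ D ∧ ∀ r ∈ D, f q ≤ f r}

/-- `β_o = (γ - 1) / ((γ - 1) + κ (2γ + p) / n + (γ + p) / (n - 1))`. -/
def betaEll (n p : ℕ) (γ κ : ℝ) : ℝ :=
  (γ - 1) / ((γ - 1) + κ * (2 * γ + (p : ℝ)) / (n : ℝ) + (γ + (p : ℝ)) / ((n : ℝ) - 1))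

/-- `α_o = (1 - β_o) η`. -/
def alphaEll (n p : ℕ) (η γ κ : ℝ) : ℝ := (1 - betaEll n p γ κ) * η

end EllShrink

end

/-! Since `S` is unbiased, the MSE splits as β² E‖S - M‖² + ‖(1 - β)M - αI‖². The second term equals
p(α - (1 - β)η)² + (1 - β)² pη²(γ - 1), and the first is β² pη² A with A = κ(2γ + p)/n + (γ + p)/(n
- 1). Completing the square in β leaves a constant plus two squares, which vanish together exactly
at the stated pair, provided A > 0.

Two facts carry this. The value of A comes from the second moments of the entries of `S`
(`integral_scatter_sq`) and the fourth moments of an elliptical law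
(`IsElliptical.integral_sq_mul_sq`). For the latter, reflections that preserve the quadratic form
preserve the law, so fourth moments of linear forms are a constant times the squared variance;
polarization gives the mixed moments, and whitening identifies the constant as a multiple of 1 + κ.

Positivity of A (`IsElliptical.normalized_error_pos`) is not immediate, as κ may be negative:
Var(r²) ≥ 0 gives κ ≥ -2/(p + 2), and 1/n < 1/(n - 1) makes the inequality strict. -/

noncomputable section

namespace EllShrink

/-! ### Second moments of sample cross-covariances of an i.i.d. family -/

section FourthMoments

variable {Ω E : Type*} [MeasurableSpace Ω] [MeasurableSpace E] {Pr : Measure Ω} {P : Measure E}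

lemma memLp_two_mul {f g : Ω → ℝ} (hf : MemLp f 4 Pr) (hg : MemLp g 4 Pr) :
    MemLp (fun ω => f ω * g ω) 2 Pr := by
  have : ENNReal.HolderTriple 4 4 2 := ⟨by
    have h : (4 : ENNReal)⁻¹ = 2⁻¹ * 2⁻¹ := by
      rw [← ENNReal.mul_inv (by simp) (by simp)]; norm_num
    rw [h, ← mul_add, ENNReal.inv_two_add_inv_two, mul_one]⟩
  exact hg.mul' hf

lemma integrable_mul_four {f₁ f₂ f₃ f₄ : Ω → ℝ} (h₁ : MemLp f₁ 4 Pr) (h₂ : MemLp f₂ 4 Pr)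
    (h₃ : MemLp f₃ 4 Pr) (h₄ : MemLp f₄ 4 Pr) :
    Integrable (fun ω => f₁ ω * f₂ ω * (f₃ ω * f₄ ω)) Pr :=
  (memLp_two_mul h₁ h₂).integrable_mul (memLp_two_mul h₃ h₄)

variable {ι : Type*} {X : ι → Ω → E}

lemma memLp_comp_of_hasLaw {φ : E → ℝ} {q : ENNReal} {Y : Ω → E} (hY : HasLaw Y P Pr)
    (hφ : MemLp φ q P) : MemLp (fun ω => φ (Y ω)) q Pr := by
  rw [← hY.map_eq] at hφ
  exact hφ.comp_of_map hY.aemeasurable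

lemma integral_comp_of_hasLaw {φ : E → ℝ} {Y : Ω → E} (hY : HasLaw Y P Pr)
    (hφ : Measurable φ) : ∫ ω, φ (Y ω) ∂Pr = ∫ y, φ y ∂P :=
  hY.integral_comp (f := φ) hφ.aestronglyMeasurable

/-- For an independent family, a centered factor whose index is isolated kills the expectation. -/
lemma integral_mul_eq_zero_of_ne [DecidableEq ι] (hlaw : ∀ i, HasLaw (X i) P Pr)
    (hind : iIndepFun X Pr) {f f₁ f₂ f₃ : E → ℝ} (hf : Measurable f) (hf₁ : Measurable f₁)
    (hf₂ : Measurable f₂) (hf₃ : Measurable f₃) (h0 : ∫ y, f y ∂P = 0) {i j k l : ι}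
    (hj : j ≠ i) (hk : k ≠ i) (hl : l ≠ i) :
    ∫ ω, f (X i ω) * (f₁ (X j ω) * f₂ (X k ω) * f₃ (X l ω)) ∂Pr = 0 := by
  -- Only `i` must be isolated; `j`, `k`, `l` may coincide, hence the grouping into one block.
  have h := hind.indepFun_finset₀ {i} {j, k, l} (by simp [hj.symm, hk.symm, hl.symm])
    (fun i => (hlaw i).aemeasurable)
  have hc : ∀ (S : Finset ι) (a : S) (u : E → ℝ), Measurable u →
      Measurable fun z : S → E => u (z a) := fun S a u hu => hu.comp (measurable_pi_apply a)
  have h' := h.comp (φ := fun z => f (z ⟨i, by simp⟩))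
    (ψ := fun z => f₁ (z ⟨j, by simp⟩) * f₂ (z ⟨k, by simp⟩) * f₃ (z ⟨l, by simp⟩))
    (hc _ _ f hf) (((hc _ _ f₁ hf₁).mul (hc _ _ f₂ hf₂)).mul (hc _ _ f₃ hf₃))
  have hm : ∀ (u : E → ℝ) (_ : Measurable u) (i : ι), AEStronglyMeasurable (fun ω => u (X i ω)) Pr :=
    fun u hu i => (hu.comp_aemeasurable (hlaw i).aemeasurable).aestronglyMeasurable
  have := h'.integral_fun_mul_eq_mul_integral (hm f hf i)
    (((hm f₁ hf₁ j).mul (hm f₂ hf₂ k)).mul (hm f₃ hf₃ l))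
  simp only [Function.comp_def] at this
  rw [this, integral_comp_of_hasLaw (hlaw i) hf, h0, zero_mul]

lemma integral_mul_of_ne (hlaw : ∀ i, HasLaw (X i) P Pr)
    (hind : iIndepFun X Pr) {f g : E → ℝ} (hf : Measurable f) (hg : Measurable g) {i j : ι}
    (hij : i ≠ j) :
    ∫ ω, f (X i ω) * g (X j ω) ∂Pr = (∫ y, f y ∂P) * ∫ y, g y ∂P := by
  have h := (hind.indepFun hij).comp hf hg
  have := h.integral_fun_mul_eq_mul_integral
    (hf.comp_aemeasurable (hlaw i).aemeasurable).aestronglyMeasurable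
    (hg.comp_aemeasurable (hlaw j).aemeasurable).aestronglyMeasurable
  simp only [Function.comp_def] at this
  rw [this, integral_comp_of_hasLaw (hlaw i) hf, integral_comp_of_hasLaw (hlaw j) hg]

/-- By centering, only index patterns without an isolated index survive. The first three terms are
the pairings; all three fire when every index agrees, so the last term corrects the total there and
its coefficient is a fourth cumulant. -/
lemma integral_mul_four [DecidableEq ι] (hlaw : ∀ i, HasLaw (X i) P Pr)
    (hind : iIndepFun X Pr) {φ ψ : E → ℝ} (hφ : Measurable φ) (hψ : Measurable ψ)
    (hφ0 : ∫ y, φ y ∂P = 0) (hψ0 : ∫ y, ψ y ∂P = 0) (i j k l : ι) :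
    ∫ ω, φ (X i ω) * ψ (X j ω) * (φ (X k ω) * ψ (X l ω)) ∂Pr =
      (if i = j then 1 else 0) * (if k = l then 1 else 0) * (∫ y, φ y * ψ y ∂P) ^ 2 +
      (if i = k then 1 else 0) * (if j = l then 1 else 0) *
        ((∫ y, φ y ^ 2 ∂P) * ∫ y, ψ y ^ 2 ∂P) +
      (if i = l then 1 else 0) * (if k = j then 1 else 0) * (∫ y, φ y * ψ y ∂P) ^ 2 +
      (if i = j then 1 else 0) * (if k = l then 1 else 0) * (if i = k then 1 else 0) *
        ((∫ y, φ y ^ 2 * ψ y ^ 2 ∂P) - 2 * (∫ y, φ y * ψ y ∂P) ^ 2 -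
          (∫ y, φ y ^ 2 ∂P) * ∫ y, ψ y ^ 2 ∂P) := by
  have hφψ : Measurable fun y => φ y * ψ y := hφ.mul hψ
  by_cases hij : i = j
  · subst hij
    by_cases hkl : k = l
    · subst hkl
      by_cases hik : i = k
      · subst hik
        simp only [if_true]
        rw [integral_comp_of_hasLaw (φ := fun y => φ y * ψ y * (φ y * ψ y)) (hlaw i)
          (hφψ.mul hφψ)]
        rw [show (fun y => φ y ^ 2 * ψ y ^ 2) = fun y => φ y * ψ y * (φ y * ψ y) by ext; ring]
        ring
      · simp only [if_true, hik, if_false]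
        rw [integral_mul_of_ne hlaw hind hφψ hφψ hik]
        ring
    · by_cases hik : i = k
      · subst hik
        simp only [if_true, hkl, if_false]
        rw [show (fun ω => φ (X i ω) * ψ (X i ω) * (φ (X i ω) * ψ (X l ω))) = fun ω =>
          ψ (X l ω) * (φ (X i ω) * ψ (X i ω) * φ (X i ω)) by ext; ring]
        rw [integral_mul_eq_zero_of_ne hlaw hind hψ hφ hψ hφ hψ0 hkl hkl hkl]
        ring
      · have hki : k ≠ i := fun h => hik h.symm
        simp only [if_true, hkl, hik, hki, if_false]
        rw [show (fun ω => φ (X i ω) * ψ (X i ω) * (φ (X k ω) * ψ (X l ω))) = fun ω =>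
          φ (X k ω) * (φ (X i ω) * ψ (X i ω) * ψ (X l ω)) by ext; ring]
        rw [integral_mul_eq_zero_of_ne hlaw hind hφ hφ hψ hψ hφ0 hik hik (Ne.symm hkl)]
        ring
  · by_cases hik : i = k
    · subst hik
      by_cases hjl : j = l
      · subst hjl
        simp only [if_true, hij, if_false]
        rw [show (fun ω => φ (X i ω) * ψ (X j ω) * (φ (X i ω) * ψ (X j ω))) = fun ω =>
          φ (X i ω) ^ 2 * ψ (X j ω) ^ 2 by ext; ring]
        rw [integral_mul_of_ne hlaw hind (hφ.pow_const 2) (hψ.pow_const 2) hij]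
        ring
      · simp only [if_true, hij, hjl, if_false]
        rw [show (fun ω => φ (X i ω) * ψ (X j ω) * (φ (X i ω) * ψ (X l ω))) = fun ω =>
          ψ (X j ω) * (φ (X i ω) * φ (X i ω) * ψ (X l ω)) by ext; ring]
        rw [integral_mul_eq_zero_of_ne hlaw hind hψ hφ hφ hψ hψ0 hij hij (Ne.symm hjl)]
        ring
    · by_cases hil : i = l
      · subst hil
        have hki : k ≠ i := fun h => hik h.symm
        by_cases hkj : k = j
        · subst hkj
          simp only [if_true, hik, hki, if_false]
          rw [show (fun ω => φ (X i ω) * ψ (X k ω) * (φ (X k ω) * ψ (X i ω))) = fun ω =>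
            (φ (X i ω) * ψ (X i ω)) * (φ (X k ω) * ψ (X k ω)) by ext; ring]
          rw [integral_mul_of_ne hlaw hind hφψ hφψ hik]
          ring
        · simp only [if_true, hij, hik, hki, hkj, if_false]
          rw [show (fun ω => φ (X i ω) * ψ (X j ω) * (φ (X k ω) * ψ (X i ω))) = fun ω =>
            φ (X k ω) * (φ (X i ω) * ψ (X j ω) * ψ (X i ω)) by ext; ring]
          rw [integral_mul_eq_zero_of_ne hlaw hind hφ hφ hψ hψ hφ0 hik (Ne.symm hkj) hik]
          ring
      · simp only [hij, hik, hil, if_false]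
        rw [show (fun ω => φ (X i ω) * ψ (X j ω) * (φ (X k ω) * ψ (X l ω))) = fun ω =>
          φ (X i ω) * (ψ (X j ω) * φ (X k ω) * ψ (X l ω)) by ext; ring]
        rw [integral_mul_eq_zero_of_ne hlaw hind hφ hψ hφ hψ hφ0 (Ne.symm hij) (Ne.symm hik)
          (Ne.symm hil)]
        ring

lemma integral_mul_two [DecidableEq ι] [IsProbabilityMeasure Pr] (hlaw : ∀ i, HasLaw (X i) P Pr)
    (hind : iIndepFun X Pr) {φ ψ : E → ℝ} (hφ : Measurable φ) (hψ : Measurable ψ)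
    (hφ0 : ∫ y, φ y ∂P = 0) (i j : ι) :
    ∫ ω, φ (X i ω) * ψ (X j ω) ∂Pr = (if i = j then 1 else 0) * ∫ y, φ y * ψ y ∂P := by
  by_cases hij : i = j
  · subst hij
    simp only [if_true, one_mul]
    exact integral_comp_of_hasLaw (hlaw i) (hφ.mul hψ)
  · rw [integral_mul_of_ne hlaw hind hφ hψ hij, hφ0]
    simp [hij]

/-- The entries of the centering matrix `I - n⁻¹ 1 1ᵀ`. -/
def centering (n : ℕ) (i j : Fin n) : ℝ := (if i = j then 1 else 0) - (n : ℝ)⁻¹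

lemma sum_centering_diag {n : ℕ} (hn : n ≠ 0) : ∑ i : Fin n, centering n i i = (n : ℝ) - 1 := by
  have : (n : ℝ) ≠ 0 := by exact_mod_cast hn
  simp [centering, this]

/-- The centering matrix is a symmetric idempotent, so its bilinear form is the inner product of the
centered vectors. -/
lemma sum_centering_mul {n : ℕ} (hn : n ≠ 0) (u v : Fin n → ℝ) :
    ∑ i, ∑ j, centering n i j * (u i * v j) =
      ∑ i, (u i - (n : ℝ)⁻¹ * ∑ k, u k) * (v i - (n : ℝ)⁻¹ * ∑ k, v k) := by
  have hn' : (n : ℝ) ≠ 0 := by exact_mod_cast hn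
  have h1 : ∑ i, ∑ j, centering n i j * (u i * v j) =
      ∑ i, u i * v i - (n : ℝ)⁻¹ * ((∑ i, u i) * ∑ i, v i) := by
    simp only [centering, sub_mul, Finset.sum_sub_distrib, ite_mul, one_mul, zero_mul,
      Finset.sum_ite_eq, Finset.mem_univ, if_true]
    rw [Finset.sum_mul_sum]
    simp only [Finset.mul_sum]
  rw [h1]
  simp only [sub_mul, mul_sub, Finset.sum_sub_distrib, ← Finset.sum_mul, ← Finset.mul_sum,
    Finset.sum_const, Finset.card_univ, Fintype.card_fin, nsmul_eq_mul]
  field_simp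
  ring

lemma sum_centering_sq {n : ℕ} (hn : n ≠ 0) :
    ∑ i : Fin n, ∑ j, centering n i j * centering n i j = (n : ℝ) - 1 := by
  have hn' : (n : ℝ) ≠ 0 := by exact_mod_cast hn
  simp only [centering, sub_mul, mul_sub, Finset.sum_sub_distrib, ite_mul, mul_ite, one_mul,
    zero_mul, mul_one, mul_zero, Finset.sum_ite_eq, Finset.mem_univ, if_true, Finset.sum_const,
    Finset.card_univ, Fintype.card_fin, nsmul_eq_mul]
  field_simp
  ring

/-- For the centering matrix C, the pairings contribute (tr C)², tr C² and tr C² again, with tr C =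
tr C² = n - 1; the full diagonal contributes ∑ Cᵢᵢ² = n(1 - 1/n)². -/
lemma sum_centering_four {n : ℕ} (hn : n ≠ 0) (c s m : ℝ) :
    ∑ i : Fin n, ∑ j, ∑ k, ∑ l, centering n i j * centering n k l *
      ((if i = j then 1 else 0) * (if k = l then 1 else 0) * c +
      (if i = k then 1 else 0) * (if j = l then 1 else 0) * s +
      (if i = l then 1 else 0) * (if k = j then 1 else 0) * c +
      (if i = j then 1 else 0) * (if k = l then 1 else 0) * (if i = k then 1 else 0) * m) =
    ((n : ℝ) - 1) ^ 2 * c + ((n : ℝ) - 1) * (s + c) + ((n : ℝ) - 1) ^ 2 / n * m := by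
  have hn' : (n : ℝ) ≠ 0 := by exact_mod_cast hn
  have hsymm : ∀ i j : Fin n, centering n j i = centering n i j := fun i j => by
    simp [centering, eq_comm]
  have e1 : ∑ i : Fin n, ∑ j, ∑ k, ∑ l, centering n i j * centering n k l *
      ((if i = j then 1 else 0) * (if k = l then 1 else 0) * c) = ((n : ℝ) - 1) ^ 2 * c := by
    simp only [ite_mul, mul_ite, one_mul, zero_mul, mul_zero, Finset.sum_ite_eq,
      Finset.mem_univ, if_true, Finset.sum_ite_irrel, Finset.sum_const_zero]
    rw [← sum_centering_diag hn, pow_two, Finset.sum_mul_sum, Finset.sum_mul]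
    simp only [Finset.sum_mul]
  have e2 : ∑ i : Fin n, ∑ j, ∑ k, ∑ l, centering n i j * centering n k l *
      ((if i = k then 1 else 0) * (if j = l then 1 else 0) * s) = ((n : ℝ) - 1) * s := by
    simp only [ite_mul, mul_ite, one_mul, zero_mul, mul_zero, Finset.sum_ite_eq,
      Finset.mem_univ, if_true]
    rw [← sum_centering_sq hn]
    simp only [Finset.sum_mul]
  have e3 : ∑ i : Fin n, ∑ j, ∑ k, ∑ l, centering n i j * centering n k l *
      ((if i = l then 1 else 0) * (if k = j then 1 else 0) * c) = ((n : ℝ) - 1) * c := by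
    rw [← sum_centering_sq hn]
    simp only [Finset.sum_mul]
    refine Finset.sum_congr rfl fun i _ => Finset.sum_congr rfl fun j _ => ?_
    rw [Finset.sum_eq_single j (fun k _ hk => by simp [hk]) (by simp),
      Finset.sum_eq_single i (fun l _ hl => by simp [hl.symm]) (by simp), hsymm]
    simp [hsymm]
  have e4 : ∑ i : Fin n, ∑ j, ∑ k, ∑ l, centering n i j * centering n k l *
      ((if i = j then 1 else 0) * (if k = l then 1 else 0) * (if i = k then 1 else 0) * m) =
      ((n : ℝ) - 1) ^ 2 / n * m := by
    simp only [ite_mul, mul_ite, one_mul, zero_mul, mul_zero]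
    simp [centering]
    field_simp
  simp only [mul_add (centering _ _ _ * _), Finset.sum_add_distrib, e1, e2, e3, e4]
  ring

/-- The `n - 1` multiple of the sample cross-covariance of `φ` and `ψ`. -/
def scatter {n : ℕ} (X : Fin n → Ω → E) (φ ψ : E → ℝ) (ω : Ω) : ℝ :=
  ∑ i, ∑ j, centering n i j * (φ (X i ω) * ψ (X j ω))

variable {n : ℕ} {Y : Fin n → Ω → E} {φ ψ : E → ℝ}

lemma memLp_scatter (hlaw : ∀ i, HasLaw (Y i) P Pr) (hφ : MemLp φ 4 P) (hψ : MemLp ψ 4 P) :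
    MemLp (scatter Y φ ψ) 2 Pr :=
  memLp_finsetSum _ fun i _ => memLp_finsetSum _ fun j _ =>
    (memLp_two_mul (memLp_comp_of_hasLaw (hlaw i) hφ)
      (memLp_comp_of_hasLaw (hlaw j) hψ)).const_mul _

lemma integral_scatter [IsProbabilityMeasure Pr] (hn : n ≠ 0) (hlaw : ∀ i, HasLaw (Y i) P Pr)
    (hind : iIndepFun Y Pr) (hφm : Measurable φ) (hψm : Measurable ψ) (hφ : MemLp φ 4 P)
    (hψ : MemLp ψ 4 P) (hφ0 : ∫ y, φ y ∂P = 0) :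
    ∫ ω, scatter Y φ ψ ω ∂Pr = ((n : ℝ) - 1) * ∫ y, φ y * ψ y ∂P := by
  have hi : ∀ i j, Integrable (fun ω => centering n i j * (φ (Y i ω) * ψ (Y j ω))) Pr :=
    fun i j => ((memLp_two_mul (memLp_comp_of_hasLaw (hlaw i) hφ)
      (memLp_comp_of_hasLaw (hlaw j) hψ)).integrable (by norm_num)).const_mul _
  simp only [scatter]
  rw [integral_finsetSum _ fun i _ => integrable_finsetSum _ fun j _ => hi i j,
    ← sum_centering_diag hn, Finset.sum_mul]
  refine Finset.sum_congr rfl fun i _ => ?_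
  rw [integral_finsetSum _ fun j _ => hi i j]
  simp [integral_const_mul, integral_mul_two hlaw hind hφm hψm hφ0]

lemma integral_scatter_sq (hn : n ≠ 0) (hlaw : ∀ i, HasLaw (Y i) P Pr)
    (hind : iIndepFun Y Pr) (hφm : Measurable φ) (hψm : Measurable ψ) (hφ : MemLp φ 4 P)
    (hψ : MemLp ψ 4 P) (hφ0 : ∫ y, φ y ∂P = 0) (hψ0 : ∫ y, ψ y ∂P = 0) :
    ∫ ω, scatter Y φ ψ ω ^ 2 ∂Pr = ((n : ℝ) - 1) ^ 2 * (∫ y, φ y * ψ y ∂P) ^ 2 +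
      ((n : ℝ) - 1) * ((∫ y, φ y ^ 2 ∂P) * (∫ y, ψ y ^ 2 ∂P) + (∫ y, φ y * ψ y ∂P) ^ 2) +
      ((n : ℝ) - 1) ^ 2 / n * ((∫ y, φ y ^ 2 * ψ y ^ 2 ∂P) - 2 * (∫ y, φ y * ψ y ∂P) ^ 2 -
          (∫ y, φ y ^ 2 ∂P) * ∫ y, ψ y ^ 2 ∂P) := by
  have hi : ∀ i j k l, Integrable (fun ω => centering n i j * centering n k l *
      (φ (Y i ω) * ψ (Y j ω) * (φ (Y k ω) * ψ (Y l ω)))) Pr := fun i j k l =>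
    (integrable_mul_four (memLp_comp_of_hasLaw (hlaw i) hφ) (memLp_comp_of_hasLaw (hlaw j) hψ)
      (memLp_comp_of_hasLaw (hlaw k) hφ) (memLp_comp_of_hasLaw (hlaw l) hψ)).const_mul _
  have hsq : ∀ ω, scatter Y φ ψ ω ^ 2 = ∑ i, ∑ j, ∑ k, ∑ l, centering n i j * centering n k l *
      (φ (Y i ω) * ψ (Y j ω) * (φ (Y k ω) * ψ (Y l ω))) := fun ω => by
    simp only [scatter, pow_two, Finset.sum_mul, Finset.mul_sum]
    refine Finset.sum_congr rfl fun i _ => Finset.sum_congr rfl fun j _ =>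
      Finset.sum_congr rfl fun k _ => Finset.sum_congr rfl fun l _ => ?_
    ring
  simp only [hsq]
  rw [← sum_centering_four hn, integral_finsetSum _ fun i _ => integrable_finsetSum _ fun j _ =>
    integrable_finsetSum _ fun k _ => integrable_finsetSum _ fun l _ => hi i j k l]
  refine Finset.sum_congr rfl fun i _ => ?_
  rw [integral_finsetSum _ fun j _ =>
    integrable_finsetSum _ fun k _ => integrable_finsetSum _ fun l _ => hi i j k l]
  refine Finset.sum_congr rfl fun j _ => ?_
  rw [integral_finsetSum _ fun k _ => integrable_finsetSum _ fun l _ => hi i j k l]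
  refine Finset.sum_congr rfl fun k _ => ?_
  rw [integral_finsetSum _ fun l _ => hi i j k l]
  refine Finset.sum_congr rfl fun l _ => ?_
  rw [integral_const_mul, integral_mul_four hlaw hind hφm hψm hφ0 hψ0]

end FourthMoments

end EllShrink

end

noncomputable section

namespace EllShrink

/-! ### Reflection invariance and fourth moments of elliptical laws -/

section Elliptical

variable {p : ℕ} {P : Measure (Fin p → ℝ)} {μ : Fin p → ℝ} {M : Matrix (Fin p) (Fin p) ℝ}
  {g : ℝ → ℝ}

/-- The reflection `y ↦ y - 2 (dᵀ y / dᵀ M d) M d`, orthogonal for the form `M⁻¹`. -/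
def reflect (M : Matrix (Fin p) (Fin p) ℝ) (d : Fin p → ℝ) : (Fin p → ℝ) →ₗ[ℝ] (Fin p → ℝ) where
  toFun y := y - (2 * (d ⬝ᵥ y) / (d ⬝ᵥ (M *ᵥ d))) • (M *ᵥ d)
  map_add' y z := by
    ext i; simp only [dotProduct_add, Pi.sub_apply, Pi.add_apply, Pi.smul_apply, smul_eq_mul]; ring
  map_smul' c y := by
    ext i; simp only [dotProduct_smul, Pi.sub_apply, Pi.smul_apply, smul_eq_mul, RingHom.id_apply]
    ring

lemma reflect_apply (M : Matrix (Fin p) (Fin p) ℝ) (d y : Fin p → ℝ) :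
    reflect M d y = y - (2 * (d ⬝ᵥ y) / (d ⬝ᵥ (M *ᵥ d))) • (M *ᵥ d) := rfl

lemma reflect_reflect {d : Fin p → ℝ} (hd : d ⬝ᵥ (M *ᵥ d) ≠ 0) (y : Fin p → ℝ) :
    reflect M d (reflect M d y) = y := by
  ext i
  simp only [reflect_apply, dotProduct_sub, dotProduct_smul, Pi.sub_apply, Pi.smul_apply,
    smul_eq_mul]
  field_simp
  ring

/-- An involution has determinant ±1. -/
lemma measurePreserving_reflect {d : Fin p → ℝ} (hd : d ⬝ᵥ (M *ᵥ d) ≠ 0) :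
    MeasurePreserving (reflect M d) volume volume := by
  have hT : reflect M d * reflect M d = 1 := LinearMap.ext fun y => reflect_reflect hd y
  have hdet : LinearMap.det (reflect M d) * LinearMap.det (reflect M d) = 1 := by
    rw [← map_mul, hT, map_one]
  have habs : |LinearMap.det (reflect M d)| = 1 := by
    rcases mul_self_eq_one_iff.mp hdet with h | h <;> simp [h]
  refine ⟨(reflect M d).continuous_of_finiteDimensional.measurable, ?_⟩
  rw [Real.map_linearMap_volume_pi_eq_smul_volume_pi (by intro h; simp [h] at habs), abs_inv, habs]
  simp

lemma quadForm_reflect (hM : M.PosDef) {d : Fin p → ℝ} (hd : d ⬝ᵥ (M *ᵥ d) ≠ 0)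
    (x : Fin p → ℝ) : quadForm μ M (μ + reflect M d (x - μ)) = quadForm μ M x := by
  have hdet : IsUnit M.det := hM.det_pos.ne'.isUnit
  have hMi : M⁻¹ *ᵥ (M *ᵥ d) = d := by
    rw [mulVec_mulVec, Matrix.nonsing_inv_mul _ hdet, one_mulVec]
  have hMt : M⁻¹ᵀ = M⁻¹ := by
    have := hM.1.inv
    simpa [Matrix.IsHermitian] using this
  have hs : (M *ᵥ d) ⬝ᵥ (M⁻¹ *ᵥ (x - μ)) = d ⬝ᵥ (x - μ) := by
    rw [dotProduct_mulVec, ← mulVec_transpose, hMt, hMi]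
  unfold quadForm
  rw [add_sub_cancel_left, reflect_apply]
  simp only [mulVec_sub, mulVec_smul, hMi, dotProduct_sub, sub_dotProduct, dotProduct_smul,
    smul_dotProduct, smul_eq_mul]
  have hs' : (M *ᵥ d) ⬝ᵥ (M⁻¹ *ᵥ x) - (M *ᵥ d) ⬝ᵥ (M⁻¹ *ᵥ μ) = d ⬝ᵥ x - d ⬝ᵥ μ := by
    simpa only [mulVec_sub, dotProduct_sub] using hs
  have hc : ∀ z, z ⬝ᵥ d = d ⬝ᵥ z := fun z => dotProduct_comm _ _
  simp only [hc]
  -- The cross terms equal -4(dᵀy)²/(dᵀMd) with y = x - μ, and the square of the shift is its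
  -- opposite once one factor dᵀMd is cancelled.
  linear_combination (exp := 1) (-(2 * (d ⬝ᵥ x - d ⬝ᵥ μ) / (d ⬝ᵥ (M *ᵥ d)))) * hs' +
    (4 * (d ⬝ᵥ x - d ⬝ᵥ μ) ^ 2 / (d ⬝ᵥ (M *ᵥ d))) * (div_self hd)

lemma measurable_quadForm : Measurable (quadForm μ M) := by
  unfold quadForm dotProduct mulVec dotProduct
  fun_prop

lemma IsElliptical.measurePreserving_reflect (hP : IsElliptical P μ M g) {d : Fin p → ℝ}
    (hd : d ⬝ᵥ (M *ᵥ d) ≠ 0) :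
    MeasurePreserving (fun x => μ + reflect M d (x - μ)) P P := by
  have hvol : MeasurePreserving (fun x => μ + reflect M d (x - μ)) volume volume :=
    ((measurePreserving_add_left volume μ).comp (EllShrink.measurePreserving_reflect hd)).comp
      (measurePreserving_sub_right volume μ)
  refine ⟨hvol.measurable, ?_⟩
  obtain ⟨C, -, hC⟩ := hP.density
  have hρ : Measurable fun x =>
      ENNReal.ofReal (C * (Real.sqrt M.det)⁻¹ * g (quadForm μ M x)) :=
    ((hP.measurable_generator.comp measurable_quadForm).const_mul _).ennreal_ofReal
  ext A hA
  rw [Measure.map_apply hvol.measurable hA, hC, withDensity_apply _ hA,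
    withDensity_apply _ (hvol.measurable hA), ← hvol.setLIntegral_comp_preimage hA hρ]
  simp only [quadForm_reflect hP.posDef hd]

/-- The law of a centered linear form depends only on its variance. -/
lemma IsElliptical.integral_linear_congr (hP : IsElliptical P μ M g) {F : ℝ → ℝ}
    (hF : Measurable F) {w v : Fin p → ℝ} (h : w ⬝ᵥ (M *ᵥ w) = v ⬝ᵥ (M *ᵥ v)) :
    ∫ x, F (w ⬝ᵥ (x - μ)) ∂P = ∫ x, F (v ⬝ᵥ (x - μ)) ∂P := by
  by_cases hwv : w - v = 0
  · rw [sub_eq_zero.mp hwv]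
  have hd : 0 < (w - v) ⬝ᵥ (M *ᵥ (w - v)) := by
    simpa using hP.posDef.dotProduct_mulVec_pos hwv
  have hMt : Mᵀ = M := by simpa [Matrix.IsHermitian] using hP.posDef.1
  have hsym : v ⬝ᵥ (M *ᵥ w) = w ⬝ᵥ (M *ᵥ v) := by
    rw [dotProduct_mulVec, ← mulVec_transpose, hMt, dotProduct_comm]
  have hmp := hP.measurePreserving_reflect hd.ne'
  have hmeas : Measurable fun x : Fin p → ℝ => F (w ⬝ᵥ (x - μ)) := by
    refine hF.comp ?_
    unfold dotProduct
    fun_prop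
  -- Reflecting along `w - v` turns the form `w` into the form `v`: equal variances give dᵀMd = 2
  -- wᵀMd for d = w - v. One reflection therefore replaces the whole orthogonal group of M⁻¹.
  have hkey : ∀ x, w ⬝ᵥ (μ + reflect M (w - v) (x - μ) - μ) = v ⬝ᵥ (x - μ) := fun x => by
    rw [add_sub_cancel_left, reflect_apply, dotProduct_sub, dotProduct_smul, smul_eq_mul]
    have hq : (w - v) ⬝ᵥ (M *ᵥ (w - v)) = 2 * (w ⬝ᵥ (M *ᵥ (w - v))) := by
      simp only [mulVec_sub, dotProduct_sub, sub_dotProduct]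
      linarith
    have hne : w ⬝ᵥ (M *ᵥ (w - v)) ≠ 0 := fun h0 => by rw [hq, h0] at hd; simp at hd
    rw [hq, sub_dotProduct w v]
    field_simp
    ring
  have := integral_map (μ := P) hmp.measurable.aemeasurable (f := fun x => F (w ⬝ᵥ (x - μ)))
    (by rw [hmp.map_eq]; exact hmeas.aestronglyMeasurable)
  rw [hmp.map_eq] at this
  rw [this]
  simp only [hkey]

lemma memLp_linear [IsFiniteMeasure P] {q : ENNReal}
    (h : ∀ i, MemLp (fun x : Fin p → ℝ => x i) q P) (w : Fin p → ℝ) :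
    MemLp (fun x => w ⬝ᵥ (x - μ)) q P := by
  unfold dotProduct
  refine memLp_finsetSum _ fun i _ => ?_
  exact ((h i).sub (memLp_const (μ i))).const_mul (w i)

/-- Any form has the variance of a multiple of one fixed nonzero form `e`, so homogeneity reduces
every fourth moment to that of `e`. -/
lemma IsElliptical.exists_integral_pow_four (hP : IsElliptical P μ M g) (hp : 1 ≤ p) :
    ∃ m : ℝ, ∀ w, ∫ x, (w ⬝ᵥ (x - μ)) ^ 4 ∂P = m * (w ⬝ᵥ (M *ᵥ w)) ^ 2 := by
  set e : Fin p → ℝ := fun _ => 1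
  have he : e ≠ 0 := fun h => by simpa [e] using congrFun h ⟨0, hp⟩
  have hq : 0 < e ⬝ᵥ (M *ᵥ e) := by simpa using hP.posDef.dotProduct_mulVec_pos he
  refine ⟨(∫ x, (e ⬝ᵥ (x - μ)) ^ 4 ∂P) / (e ⬝ᵥ (M *ᵥ e)) ^ 2, fun w => ?_⟩
  have hw : 0 ≤ w ⬝ᵥ (M *ᵥ w) := by
    simpa using hP.posDef.posSemidef.dotProduct_mulVec_nonneg w
  set c := Real.sqrt (w ⬝ᵥ (M *ᵥ w) / (e ⬝ᵥ (M *ᵥ e)))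
  have hc : c ^ 2 = w ⬝ᵥ (M *ᵥ w) / (e ⬝ᵥ (M *ᵥ e)) := Real.sq_sqrt (by positivity)
  have h : w ⬝ᵥ (M *ᵥ w) = (c • e) ⬝ᵥ (M *ᵥ (c • e)) := by
    rw [mulVec_smul, smul_dotProduct, dotProduct_smul, smul_eq_mul, smul_eq_mul, ← mul_assoc,
      ← pow_two, hc]
    field_simp
  rw [hP.integral_linear_congr (F := fun t => t ^ 4) (by fun_prop) h]
  simp only [smul_dotProduct, smul_eq_mul, mul_pow]
  rw [integral_const_mul, show c ^ 4 = (c ^ 2) ^ 2 by ring, hc]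
  field_simp

lemma IsElliptical.exists_integral_sq_mul_sq (hP : IsElliptical P μ M g)
    (h4 : HasFiniteFourthMoments P) (hp : 1 ≤ p) :
    ∃ m : ℝ, ∀ w v, ∫ x, (w ⬝ᵥ (x - μ)) ^ 2 * (v ⬝ᵥ (x - μ)) ^ 2 ∂P =
      m * ((w ⬝ᵥ (M *ᵥ w)) * (v ⬝ᵥ (M *ᵥ v)) + 2 * (w ⬝ᵥ (M *ᵥ v)) ^ 2) := by
  obtain ⟨m, hm⟩ := hP.exists_integral_pow_four hp
  have := hP.isProbabilityMeasure
  have hMt : Mᵀ = M := by simpa [Matrix.IsHermitian] using hP.posDef.1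
  -- Polarization: 12a²b² = (a + b)⁴ + (a - b)⁴ - 2a⁴ - 2b⁴. On the variance side the same
  -- combination yields 4(wᵀMw)(vᵀMv) + 8(wᵀMv)², whence the factor 1/3.
  refine ⟨m / 3, fun w v => ?_⟩
  have hsym : v ⬝ᵥ (M *ᵥ w) = w ⬝ᵥ (M *ᵥ v) := by
    rw [dotProduct_mulVec, ← mulVec_transpose, hMt, dotProduct_comm]
  have hI : ∀ u : Fin p → ℝ, Integrable (fun x => (u ⬝ᵥ (x - μ)) ^ 4) P := fun u => by
    have h := memLp_linear (μ := μ) h4 u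
    refine (integrable_mul_four h h h h).congr (ae_of_all _ fun x => ?_)
    ring
  have hfun : (fun x => (w ⬝ᵥ (x - μ)) ^ 2 * (v ⬝ᵥ (x - μ)) ^ 2) = fun x =>
      (1 / 12) * (((w + v) ⬝ᵥ (x - μ)) ^ 4 + ((w - v) ⬝ᵥ (x - μ)) ^ 4 -
        2 * (w ⬝ᵥ (x - μ)) ^ 4 - 2 * (v ⬝ᵥ (x - μ)) ^ 4) := by
    ext x
    rw [add_dotProduct, sub_dotProduct w v]
    ring
  rw [hfun, integral_const_mul, integral_sub, integral_sub, integral_add, integral_const_mul,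
    integral_const_mul, hm, hm, hm, hm]
  · simp only [mulVec_add, mulVec_sub, dotProduct_add, dotProduct_sub, add_dotProduct,
      sub_dotProduct, hsym]
    ring
  · exact hI _
  · exact hI _
  · exact (hI _).add (hI _)
  · exact (hI _).const_mul _
  · exact ((hI _).add (hI _)).sub ((hI _).const_mul _)
  · exact (hI _).const_mul _

lemma IsElliptical.integral_linear (hP : IsElliptical P μ M g) (w : Fin p → ℝ) :
    ∫ x, w ⬝ᵥ (x - μ) ∂P = 0 := by
  have := hP.isProbabilityMeasure
  have hi : ∀ i, Integrable (fun x : Fin p → ℝ => x i) P := fun i =>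
    (hP.memLp_two i).integrable (by norm_num)
  have hi' : ∀ i, Integrable (fun x : Fin p → ℝ => w i * (x i - μ i)) P := fun i =>
    ((hi i).sub (integrable_const _)).const_mul _
  simp only [dotProduct, Pi.sub_apply]
  rw [integral_finsetSum _ fun i _ => hi' i]
  refine Finset.sum_eq_zero fun i _ => ?_
  rw [integral_const_mul, integral_sub (hi i) (integrable_const _), hP.mean_eq]
  simp

lemma IsElliptical.integral_linear_sq (hP : IsElliptical P μ M g) (w : Fin p → ℝ) :
    ∫ x, (w ⬝ᵥ (x - μ)) ^ 2 ∂P = w ⬝ᵥ (M *ᵥ w) := by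
  have := hP.isProbabilityMeasure
  have hi : ∀ i, MemLp (fun x : Fin p → ℝ => x i - μ i) 2 P := fun i =>
    (hP.memLp_two i).sub (memLp_const _)
  have hij : ∀ i j, Integrable (fun x : Fin p → ℝ => (x i - μ i) * (x j - μ j)) P := fun i j =>
    (hi i).integrable_mul (hi j)
  have hf : (fun x => (w ⬝ᵥ (x - μ)) ^ 2) = fun x : Fin p → ℝ =>
      ∑ i, ∑ j, (w i * w j) * ((x i - μ i) * (x j - μ j)) := by
    ext x
    simp only [dotProduct, Pi.sub_apply, pow_two, Finset.sum_mul_sum]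
    refine Finset.sum_congr rfl fun i _ => Finset.sum_congr rfl fun j _ => ?_
    ring
  rw [hf, integral_finsetSum _ fun i _ => integrable_finsetSum _ fun j _ => (hij i j).const_mul _]
  simp only [dotProduct, mulVec, Finset.mul_sum]
  refine Finset.sum_congr rfl fun i _ => ?_
  rw [integral_finsetSum _ fun j _ => (hij i j).const_mul _]
  refine Finset.sum_congr rfl fun j _ => ?_
  rw [integral_const_mul, hP.covariance_eq]
  ring

open scoped MatrixOrder in
/-- Whitening: the quadratic form is a sum of squares of uncorrelated standardized forms. -/
lemma exists_quadForm_eq_sum_sq (hM : M.PosDef) : ∃ w : Fin p → Fin p → ℝ,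
    (∀ x, quadForm μ M x = ∑ a, (w a ⬝ᵥ (x - μ)) ^ 2) ∧
      ∀ a b, w a ⬝ᵥ (M *ᵥ w b) = if a = b then 1 else 0 := by
  have hdet : IsUnit M.det := hM.det_pos.ne'.isUnit
  obtain ⟨B, hB⟩ : ∃ B : Matrix (Fin p) (Fin p) ℝ, M⁻¹ = Bᵀ * B := by
    exact CStarAlgebra.nonneg_iff_eq_star_mul_self.mp hM.inv.posSemidef.nonneg
  refine ⟨fun a => B a, fun x => ?_, fun a b => ?_⟩
  · unfold quadForm
    rw [hB, ← mulVec_mulVec, mulVec_transpose, dotProduct_comm, ← dotProduct_mulVec]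
    simp [dotProduct, mulVec, pow_two]
  · have h1 : M * (Bᵀ * B) = 1 := by rw [← hB, Matrix.mul_nonsing_inv _ hdet]
    -- A one-sided inverse of a square matrix is two-sided, so the rows of `B` are orthonormal for
    -- M.
    have h2 : B * (M * Bᵀ) = 1 := by
      rw [← Matrix.mul_assoc] at h1
      exact mul_eq_one_comm.mp h1
    have := congrFun (congrFun h2 a) b
    rw [Matrix.one_apply] at this
    rw [← this]
    simp [Matrix.mul_apply, dotProduct, mulVec]

lemma IsElliptical.integrable_quadForm_sq (hP : IsElliptical P μ M g)
    (h4 : HasFiniteFourthMoments P) : Integrable (fun x => quadForm μ M x ^ 2) P := by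
  have := hP.isProbabilityMeasure
  obtain ⟨w, hw, -⟩ := exists_quadForm_eq_sum_sq (μ := μ) hP.posDef
  simp only [hw]
  refine MemLp.integrable_sq (memLp_finsetSum _ fun a _ => ?_)
  simp only [pow_two]
  exact memLp_two_mul (memLp_linear h4 _) (memLp_linear h4 _)

lemma IsElliptical.integral_quadForm (hP : IsElliptical P μ M g) :
    ∫ x, quadForm μ M x ∂P = p := by
  have := hP.isProbabilityMeasure
  obtain ⟨w, hw, hw1⟩ := exists_quadForm_eq_sum_sq (μ := μ) hP.posDef
  simp only [hw]
  rw [integral_finsetSum _ fun a _ => (memLp_linear hP.memLp_two _).integrable_sq]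
  simp only [hP.integral_linear_sq, hw1]
  simp

/-- This is Var(r²) ≥ 0 with E[r²] = p; it supplies the lower bound on κ. -/
lemma IsElliptical.sq_le_integral_quadForm_sq (hP : IsElliptical P μ M g)
    (h4 : HasFiniteFourthMoments P) : (p : ℝ) ^ 2 ≤ ∫ x, quadForm μ M x ^ 2 ∂P := by
  have := hP.isProbabilityMeasure
  have hL : MemLp (quadForm μ M) 2 P :=
    (memLp_two_iff_integrable_sq measurable_quadForm.aestronglyMeasurable).2
      (hP.integrable_quadForm_sq h4)
  have h := variance_nonneg (quadForm μ M) P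
  rw [variance_eq_sub hL, hP.integral_quadForm] at h
  simpa using h

lemma IsElliptical.integral_sq_mul_sq (hP : IsElliptical P μ M g)
    (h4 : HasFiniteFourthMoments P) (hp : 1 ≤ p) (w v : Fin p → ℝ) :
    ∫ x, (w ⬝ᵥ (x - μ)) ^ 2 * (v ⬝ᵥ (x - μ)) ^ 2 ∂P = (1 + ellipticalKurtosis P μ M) *
      ((w ⬝ᵥ (M *ᵥ w)) * (v ⬝ᵥ (M *ᵥ v)) + 2 * (w ⬝ᵥ (M *ᵥ v)) ^ 2) := by
  have := hP.isProbabilityMeasure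
  obtain ⟨m, hm⟩ := hP.exists_integral_sq_mul_sq h4 hp
  suffices hκ : m = 1 + ellipticalKurtosis P μ M by rw [hm, hκ]
  obtain ⟨w, hw, hw1⟩ := exists_quadForm_eq_sum_sq (μ := μ) hP.posDef
  have hab : ∀ a b, Integrable (fun x => (w a ⬝ᵥ (x - μ)) ^ 2 * (w b ⬝ᵥ (x - μ)) ^ 2) P :=
    fun a b => by
      simp only [pow_two]
      exact integrable_mul_four (memLp_linear h4 _) (memLp_linear h4 _) (memLp_linear h4 _)
        (memLp_linear h4 _)
  -- In whitened coordinates r⁴ is a double sum whose (a, b) term has mean m(1 + 2δ_ab), for a total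
  -- of m(p² + 2p).
  have hr : ∫ x, quadForm μ M x ^ 2 ∂P = m * (p * (p + 2)) := by
    simp only [hw, pow_two (∑ a, _), Finset.sum_mul_sum]
    rw [integral_finsetSum _ fun a _ => integrable_finsetSum _ fun b _ => hab a b]
    have : ∀ a, ∫ x, ∑ b, (w a ⬝ᵥ (x - μ)) ^ 2 * (w b ⬝ᵥ (x - μ)) ^ 2 ∂P = m * (p + 2) := by
      intro a
      rw [integral_finsetSum _ fun b _ => hab a b]
      simp only [hm, hw1]
      simp [← Finset.mul_sum, Finset.sum_add_distrib]
    simp only [this]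
    simp
    ring
  have hp' : (0 : ℝ) < p := by exact_mod_cast hp
  unfold ellipticalKurtosis
  rw [hr]
  field_simp
  ring

end Elliptical

end EllShrink

end

noncomputable section

namespace EllShrink

/-! ### Moments of the sample covariance and the MSE -/

section SampleCovariance

/-- Centering at the sample mean is insensitive to a shift by μ, so the centered coordinates needed
for the moment formulas may be used. -/
lemma sampleCov_apply {Ω : Type*} {n p : ℕ} {x : Fin n → Ω → Fin p → ℝ} (hn : n ≠ 0) (μ : Fin p → ℝ) (ω : Ω) (a b : Fin p) :
    sampleCov (fun i => x i ω) a b =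
      ((n : ℝ) - 1)⁻¹ * scatter x (fun y => y a - μ a) (fun y => y b - μ b) ω := by
  have hn' : (n : ℝ) ≠ 0 := by exact_mod_cast hn
  have hc : ∀ i c, x i ω c - sampleMean (fun i => x i ω) c =
      (x i ω c - μ c) - (n : ℝ)⁻¹ * ∑ k, (x k ω c - μ c) := fun i c => by
    simp [sampleMean, Finset.sum_apply, mul_sub, hn']
  rw [scatter, sum_centering_mul hn (fun i => x i ω a - μ a) (fun j => x j ω b - μ b)]
  simp [sampleCov, Matrix.sum_apply, vecMulVec_apply, hc]

variable {Ω : Type*} [MeasurableSpace Ω] {Pr : Measure Ω} {n p : ℕ} {P : Measure (Fin p → ℝ)}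
  {μ : Fin p → ℝ} {M : Matrix (Fin p) (Fin p) ℝ} {g : ℝ → ℝ} {x : Fin n → Ω → Fin p → ℝ}

lemma measurable_coord_sub (a : Fin p) : Measurable fun y : Fin p → ℝ => y a - μ a := by
  fun_prop

lemma memLp_coord_sub [IsFiniteMeasure P] {q : ENNReal}
    (h : ∀ i, MemLp (fun x : Fin p → ℝ => x i) q P) (a : Fin p) :
    MemLp (fun y : Fin p → ℝ => y a - μ a) q P := (h a).sub (memLp_const _)

lemma IsElliptical.integral_coord_sub (hP : IsElliptical P μ M g) (a : Fin p) :
    ∫ y, (y a - μ a) ∂P = 0 := by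
  have h := hP.integral_linear (Pi.single a 1)
  simpa only [single_one_dotProduct, Pi.sub_apply] using h

lemma IsElliptical.integral_coord_sq (hP : IsElliptical P μ M g) (a : Fin p) :
    ∫ y, (y a - μ a) ^ 2 ∂P = M a a := by
  simpa only [pow_two] using hP.covariance_eq a a

lemma IsElliptical.integral_coord_sq_mul_sq (hP : IsElliptical P μ M g)
    (h4 : HasFiniteFourthMoments P) (hp : 1 ≤ p) (a b : Fin p) :
    ∫ y, (y a - μ a) ^ 2 * (y b - μ b) ^ 2 ∂P =
      (1 + ellipticalKurtosis P μ M) * (M a a * M b b + 2 * M a b ^ 2) := by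
  have h := hP.integral_sq_mul_sq h4 hp (Pi.single a 1) (Pi.single b 1)
  simpa only [single_one_dotProduct, Pi.sub_apply, mulVec_single_one, col_apply] using h

lemma IsElliptical.memLp_sampleCov (hP : IsElliptical P μ M g) (h4 : HasFiniteFourthMoments P)
    (hn : n ≠ 0) (hlaw : ∀ i, HasLaw (x i) P Pr) (a b : Fin p) :
    MemLp (fun ω => sampleCov (fun i => x i ω) a b) 2 Pr := by
  have := hP.isProbabilityMeasure
  simp only [sampleCov_apply hn μ]
  exact (memLp_scatter hlaw (memLp_coord_sub h4 a) (memLp_coord_sub h4 b)).const_mul _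

lemma IsElliptical.integral_sampleCov [IsProbabilityMeasure Pr] (hP : IsElliptical P μ M g)
    (h4 : HasFiniteFourthMoments P) (hn : 2 ≤ n) (hlaw : ∀ i, HasLaw (x i) P Pr)
    (hind : iIndepFun x Pr) (a b : Fin p) :
    ∫ ω, sampleCov (fun i => x i ω) a b ∂Pr = M a b := by
  have := hP.isProbabilityMeasure
  have hn0 : n ≠ 0 := by omega
  have hn1 : (n : ℝ) - 1 ≠ 0 := by
    have : (2 : ℝ) ≤ n := by exact_mod_cast hn
    linarith
  simp only [sampleCov_apply hn0 μ]
  rw [integral_const_mul, integral_scatter hn0 hlaw hind (measurable_coord_sub a)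
    (measurable_coord_sub b) (memLp_coord_sub h4 a) (memLp_coord_sub h4 b)
    (hP.integral_coord_sub a), hP.covariance_eq]
  field_simp

/-- For elliptical laws the cumulant in `integral_scatter_sq` collapses to κ(M_aa M_bb + 2M_ab²),
and its weight (n - 1)²/n becomes 1/n after normalization. -/
lemma IsElliptical.integral_sampleCov_sq (hP : IsElliptical P μ M g)
    (h4 : HasFiniteFourthMoments P) (hn : 2 ≤ n) (hp : 1 ≤ p) (hlaw : ∀ i, HasLaw (x i) P Pr)
    (hind : iIndepFun x Pr) (a b : Fin p) :
    ∫ ω, sampleCov (fun i => x i ω) a b ^ 2 ∂Pr = M a b ^ 2 +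
      (M a a * M b b + M a b ^ 2) / ((n : ℝ) - 1) +
      ellipticalKurtosis P μ M * (M a a * M b b + 2 * M a b ^ 2) / n := by
  have := hP.isProbabilityMeasure
  have hn0 : n ≠ 0 := by omega
  have hn0' : (n : ℝ) ≠ 0 := by exact_mod_cast hn0
  have hn1 : (n : ℝ) - 1 ≠ 0 := by
    have : (2 : ℝ) ≤ n := by exact_mod_cast hn
    linarith
  simp only [sampleCov_apply hn0 μ, mul_pow]
  rw [integral_const_mul, integral_scatter_sq hn0 hlaw hind (measurable_coord_sub a)
    (measurable_coord_sub b) (memLp_coord_sub h4 a) (memLp_coord_sub h4 b)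
    (hP.integral_coord_sub a) (hP.integral_coord_sub b), hP.covariance_eq,
    hP.integral_coord_sq, hP.integral_coord_sq, hP.integral_coord_sq_mul_sq h4 hp]
  field_simp
  ring

lemma frobSq_eq (A : Matrix (Fin p) (Fin p) ℝ) : frobSq A = ∑ a, ∑ b, A a b ^ 2 := by
  rw [Finset.sum_comm]
  simp [frobSq, Matrix.trace, Matrix.mul_apply, pow_two]

lemma IsElliptical.memLp_rscm_sub [IsProbabilityMeasure Pr] (hP : IsElliptical P μ M g)
    (h4 : HasFiniteFourthMoments P) (hn : n ≠ 0) (hlaw : ∀ i, HasLaw (x i) P Pr) (α β : ℝ)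
    (a b : Fin p) : MemLp (fun ω => (rscm α β (fun i => x i ω) - M) a b) 2 Pr := by
  simp only [rscm, Matrix.sub_apply, Matrix.add_apply, Matrix.smul_apply, smul_eq_mul]
  exact (((hP.memLp_sampleCov h4 hn hlaw a b).const_mul β).add (memLp_const _)).sub
    (memLp_const _)

lemma IsElliptical.integrable_frobSq_rscm_sub [IsProbabilityMeasure Pr]
    (hP : IsElliptical P μ M g) (h4 : HasFiniteFourthMoments P) (hn : n ≠ 0)
    (hlaw : ∀ i, HasLaw (x i) P Pr) (α β : ℝ) :
    Integrable (fun ω => frobSq (rscm α β (fun i => x i ω) - M)) Pr := by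
  simp only [frobSq_eq]
  exact integrable_finsetSum _ fun a _ => integrable_finsetSum _ fun b _ =>
    (hP.memLp_rscm_sub h4 hn hlaw α β a b).integrable_sq

lemma IsElliptical.integral_rscm_sub_sq [IsProbabilityMeasure Pr] (hP : IsElliptical P μ M g)
    (h4 : HasFiniteFourthMoments P) (hn : 2 ≤ n) (hp : 1 ≤ p) (hlaw : ∀ i, HasLaw (x i) P Pr)
    (hind : iIndepFun x Pr) (α β : ℝ) (a b : Fin p) :
    ∫ ω, (rscm α β (fun i => x i ω) - M) a b ^ 2 ∂Pr =
      β ^ 2 * ((M a a * M b b + M a b ^ 2) / ((n : ℝ) - 1) +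
        ellipticalKurtosis P μ M * (M a a * M b b + 2 * M a b ^ 2) / n) +
      (1 - β) ^ 2 * M a b ^ 2 - 2 * α * (1 - β) * (if a = b then M a b else 0) +
      α ^ 2 * (if a = b then 1 else 0) := by
  have hL := hP.memLp_sampleCov h4 (by omega) hlaw a b
  set S : Ω → ℝ := fun ω => sampleCov (fun i => x i ω) a b with hS
  set e : ℝ := α * (1 : Matrix (Fin p) (Fin p) ℝ) a b - M a b with he
  have hf : ∀ ω, (rscm α β (fun i => x i ω) - M) a b ^ 2 =
      β ^ 2 * S ω ^ 2 + 2 * β * e * S ω + e ^ 2 := fun ω => by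
    simp only [rscm, Matrix.sub_apply, Matrix.add_apply, Matrix.smul_apply, smul_eq_mul, hS, he]
    ring
  have i1 : Integrable (fun ω => β ^ 2 * S ω ^ 2) Pr := hL.integrable_sq.const_mul _
  have i2 : Integrable (fun ω => 2 * β * e * S ω) Pr :=
    (hL.integrable (by norm_num)).const_mul _
  have i12 : Integrable (fun ω => β ^ 2 * S ω ^ 2 + 2 * β * e * S ω) Pr := i1.add i2
  simp only [hf]
  rw [integral_add i12 (integrable_const _), integral_add i1 i2, integral_const_mul,
    integral_const_mul, hP.integral_sampleCov_sq h4 hn hp hlaw hind,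
    hP.integral_sampleCov h4 hn hlaw hind, he, Matrix.one_apply]
  simp only [integral_const, probReal_univ, one_smul]
  split_ifs <;> ring

/-- The mean squared error as a function of `tr M` and `tr M²`. -/
lemma IsElliptical.rscmMSE_eq [IsProbabilityMeasure Pr] (hP : IsElliptical P μ M g)
    (h4 : HasFiniteFourthMoments P) (hn : 2 ≤ n) (hp : 1 ≤ p) (hlaw : ∀ i, HasLaw (x i) P Pr)
    (hind : iIndepFun x Pr) (q : ℝ × ℝ) :
    rscmMSE Pr x M q =
      q.2 ^ 2 * ((M.trace ^ 2 + (M * M).trace) / ((n : ℝ) - 1) +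
        ellipticalKurtosis P μ M * (M.trace ^ 2 + 2 * (M * M).trace) / n) +
      (1 - q.2) ^ 2 * (M * M).trace - 2 * q.1 * (1 - q.2) * M.trace + q.1 ^ 2 * p := by
  have hi := fun a b => (hP.memLp_rscm_sub h4 (by omega) hlaw q.1 q.2 a b).integrable_sq
  have hMt : Mᵀ = M := by simpa [Matrix.IsHermitian] using hP.posDef.1
  have hMM : (M * M).trace = ∑ a, ∑ b, M a b ^ 2 := by
    rw [← frobSq_eq, frobSq, hMt]
  have htr : M.trace ^ 2 = ∑ a, M a a * ∑ b, M b b := by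
    rw [pow_two, Matrix.trace, Finset.sum_mul]
    rfl
  unfold rscmMSE
  simp only [frobSq_eq]
  rw [integral_finsetSum _ fun a _ => integrable_finsetSum _ fun b _ => hi a b]
  simp only [integral_finsetSum _ fun b _ => hi _ b,
    hP.integral_rscm_sub_sq h4 hn hp hlaw hind, Finset.sum_add_distrib, Finset.sum_sub_distrib,
    ← Finset.mul_sum, ← Finset.sum_div, ← htr, ← hMM, Finset.sum_ite_eq, Finset.mem_univ, if_true]
  simp [Matrix.trace]

end SampleCovariance

/-! ### Minimizing the quadratic, and bounds on γ and κ -/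

section Minimization

variable {p : ℕ} {P : Measure (Fin p → ℝ)}
  {μ : Fin p → ℝ} {M : Matrix (Fin p) (Fin p) ℝ} {g : ℝ → ℝ}

/-- The domain enters only through membership of the candidate, so one completed square serves all
three domains. -/
lemma argminOn_eq_singleton {f : ℝ × ℝ → ℝ} {D : Set (ℝ × ℝ)} {c K L η αo βo : ℝ} (hK : 0 < K)
    (hL : 0 < L) (hα : αo = (1 - βo) * η)
    (hf : ∀ q, f q = c + K * (q.2 - βo) ^ 2 + L * (q.1 - (1 - q.2) * η) ^ 2)
    (ho : (αo, βo) ∈ D) : argminOn f D = {(αo, βo)} := by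
  have h0 : f (αo, βo) = c := by rw [hf, hα]; simp
  ext ⟨α, β⟩
  simp only [argminOn, Set.mem_ofPred_eq, Set.mem_singleton_iff]
  constructor
  · rintro ⟨-, h⟩
    have h := h _ ho
    rw [h0, hf] at h
    have h1 : 0 ≤ K * (β - βo) ^ 2 := by positivity
    have h2 : 0 ≤ L * (α - (1 - β) * η) ^ 2 := by positivity
    simp only at h
    have h3 : K * (β - βo) ^ 2 = 0 := by linarith
    have h4 : L * (α - (1 - β) * η) ^ 2 = 0 := by linarith
    have h5 : β = βo := by simpa [hK.ne', sub_eq_zero] using h3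
    have h6 : α = (1 - β) * η := by simpa [hL.ne', sub_eq_zero] using h4
    rw [h6, hα, h5]
  · intro h
    rw [h]
    refine ⟨ho, fun r _ => ?_⟩
    rw [h0, hf]
    have h1 : 0 ≤ K * (r.2 - βo) ^ 2 := by positivity
    have h2 : 0 ≤ L * (r.1 - (1 - r.2) * η) ^ 2 := by positivity
    linarith

lemma trace_pos_of_posDef (hM : M.PosDef) (hp : 1 ≤ p) : 0 < M.trace := by
  have : Nonempty (Fin p) := ⟨⟨0, hp⟩⟩
  exact hM.trace_pos

/-- Cauchy–Schwarz on the diagonal entries, after which the off-diagonal squares only increase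
tr(M²). -/
lemma one_le_sphericity (hM : M.PosDef) (hp : 1 ≤ p) : 1 ≤ sphericity M := by
  have ht := trace_pos_of_posDef hM hp
  have hMt : Mᵀ = M := by simpa [Matrix.IsHermitian] using hM.1
  unfold sphericity
  rw [one_le_div (by positivity)]
  calc M.trace ^ 2 ≤ p * ∑ a, M a a ^ 2 := by
        simpa [Matrix.trace] using
          sq_sum_le_card_mul_sum_sq (s := (Finset.univ : Finset (Fin p))) (f := fun a => M a a)
    _ ≤ p * (M * M).trace := by
        have h : (M * M).trace = ∑ a, ∑ b, M a b ^ 2 := by rw [← frobSq_eq, frobSq, hMt]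
        rw [h]
        refine mul_le_mul_of_nonneg_left (Finset.sum_le_sum fun a _ => ?_) (by positivity)
        exact Finset.single_le_sum (f := fun b => M a b ^ 2) (fun b _ => by positivity)
          (Finset.mem_univ a)

lemma sphericity_of_one {M : Matrix (Fin 1) (Fin 1) ℝ} (hM : M.PosDef) : sphericity M = 1 := by
  have ht : M 0 0 ≠ 0 := (by simpa [Matrix.trace] using trace_pos_of_posDef hM le_rfl :
    0 < M 0 0).ne'
  simp only [sphericity, Matrix.trace, Matrix.diag_apply, Matrix.mul_apply, Fin.sum_univ_one]
  push_cast
  field_simp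

lemma IsElliptical.neg_two_div_le_ellipticalKurtosis (hP : IsElliptical P μ M g)
    (h4 : HasFiniteFourthMoments P) (hp : 1 ≤ p) :
    -2 / ((p : ℝ) + 2) ≤ ellipticalKurtosis P μ M := by
  have hp' : (0 : ℝ) < p := by exact_mod_cast hp
  have h : (p : ℝ) ^ 2 / (p * (p + 2)) - 1 ≤ ellipticalKurtosis P μ M := by
    unfold ellipticalKurtosis
    gcongr
    exact hP.sq_le_integral_quadForm_sq h4
  refine le_trans (le_of_eq ?_) h
  field_simp
  ring

/-- The normalized mean squared error of the sample covariance matrix is positive. -/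
lemma IsElliptical.normalized_error_pos (hP : IsElliptical P μ M g)
    (h4 : HasFiniteFourthMoments P) {n : ℕ} (hn : 2 ≤ n) (hp : 1 ≤ p) :
    0 < ellipticalKurtosis P μ M * (2 * sphericity M + p) / n +
      (sphericity M + p) / ((n : ℝ) - 1) := by
  have hp' : (1 : ℝ) ≤ p := by exact_mod_cast hp
  have hn' : (2 : ℝ) ≤ n := by exact_mod_cast hn
  have hγ := one_le_sphericity hP.posDef hp
  have hκ := hP.neg_two_div_le_ellipticalKurtosis h4 hp
  -- This is 2(2γ + p) ≤ (γ + p)(p + 2) rearranged. For p = 1 the factor p - 2 is negative, and γ =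
  -- 1 gives exact equality.
  have hcmp : 0 ≤ sphericity M * (p - 2) + (p : ℝ) ^ 2 := by
    rcases Nat.lt_or_ge p 2 with h | h
    · obtain rfl : p = 1 := by omega
      rw [sphericity_of_one hP.posDef]
      norm_num
    · have h' : (2 : ℝ) ≤ p := by exact_mod_cast h
      have : 0 ≤ sphericity M * ((p : ℝ) - 2) := mul_nonneg (by linarith) (by linarith)
      positivity
  have h1 : -(sphericity M + p) ≤ ellipticalKurtosis P μ M * (2 * sphericity M + p) := by
    refine le_trans ?_ (mul_le_mul_of_nonneg_right hκ (by linarith))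
    rw [div_mul_eq_mul_div, le_div_iff₀ (by linarith)]
    nlinarith
  have h2 : -(sphericity M + p) / n ≤ ellipticalKurtosis P μ M * (2 * sphericity M + p) / n := by
    gcongr
  -- The only strict inequality: the kurtosis term can cost at most (γ + p)/n, less than the (γ +
  -- p)/(n - 1) available.
  have h3 : (sphericity M + p) / n < (sphericity M + p) / ((n : ℝ) - 1) := by
    apply div_lt_div_of_pos_left <;> linarith
  rw [neg_div] at h2
  linarith

end Minimization

end EllShrink

end

/-! ### The optimal shrinkage pair -/

theorem theorem3 {Ω : Type*} [MeasurableSpace Ω] (Pr : Measure Ω) [IsProbabilityMeasure Pr]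
    (n p : ℕ) (hn : 2 ≤ n) (hp : 1 ≤ p)
    (P : Measure (Fin p → ℝ)) (μ : Fin p → ℝ) (M : Matrix (Fin p) (Fin p) ℝ) (g : ℝ → ℝ)
    (hP : EllShrink.IsElliptical P μ M g) (h4 : EllShrink.HasFiniteFourthMoments P)
    (x : Fin n → Ω → Fin p → ℝ) (hlaw : ∀ i, HasLaw (x i) P Pr) (hindep : iIndepFun x Pr)
    (η γ κ αo βo : ℝ) (hη : η = EllShrink.scale M) (hγ : γ = EllShrink.sphericity M)
    (hκ : κ = EllShrink.ellipticalKurtosis P μ M)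
    (hα : αo = EllShrink.alphaEll n p η γ κ) (hβ : βo = EllShrink.betaEll n p γ κ) :
    -- the fourth moment of the generating variate and the MSE are genuine (finite) expectations
    Integrable (fun y => (EllShrink.quadForm μ M y) ^ 2) P ∧
    (∀ α β : ℝ, Integrable
      (fun ω => EllShrink.frobSq (EllShrink.rscm α β (fun i => x i ω) - M)) Pr) ∧
    -- the denominator of the optimal `β` does not vanish, and the optimal pair is admissible
    0 < (γ - 1) + κ * (2 * γ + (p : ℝ)) / (n : ℝ) + (γ + (p : ℝ)) / ((n : ℝ) - 1) ∧
    0 < αo ∧ 0 ≤ βo ∧ βo < 1 ∧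
    -- it is the unique minimizer of the MSE over all pairs of real numbers,
    EllShrink.argminOn (EllShrink.rscmMSE Pr x M) Set.univ = {(αo, βo)} ∧
    -- over all pairs of nonnegative numbers,
    EllShrink.argminOn (EllShrink.rscmMSE Pr x M) (Set.Ici 0 ×ˢ Set.Ici 0) = {(αo, βo)} ∧
    -- and, unless `M` is a multiple of the identity, over all pairs of positive numbers
    (γ ≠ 1 → EllShrink.argminOn (EllShrink.rscmMSE Pr x M) (Set.Ioi 0 ×ˢ Set.Ioi 0)
      = {(αo, βo)}) := by
  have hp' : (0 : ℝ) < p := by exact_mod_cast hp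
  have hn0 : n ≠ 0 := by omega
  have hn' : (2 : ℝ) ≤ n := by exact_mod_cast hn
  have ht := EllShrink.trace_pos_of_posDef hP.posDef hp
  have hη0 : 0 < η := by rw [hη, EllShrink.scale]; positivity
  have hγ1 : 1 ≤ γ := hγ ▸ EllShrink.one_le_sphericity hP.posDef hp
  have hA := hP.normalized_error_pos h4 hn hp
  rw [← hγ, ← hκ] at hA
  -- `A` is E‖S - M‖² divided by pη²; keeping it opaque leaves the square completion in terms of γ -
  -- 1 and `A` alone.
  obtain ⟨A, hAdef⟩ : ∃ A, A = κ * (2 * γ + (p : ℝ)) / n + (γ + p) / ((n : ℝ) - 1) := ⟨_, rfl⟩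
  rw [← hAdef] at hA
  have hden : (γ - 1) + κ * (2 * γ + (p : ℝ)) / (n : ℝ) + (γ + (p : ℝ)) / ((n : ℝ) - 1) =
      (γ - 1) + A := by rw [hAdef]; ring
  have hD : 0 < (γ - 1) + A := by linarith
  have hβ' : βo = (γ - 1) / ((γ - 1) + A) := by rw [hβ, EllShrink.betaEll, hden]
  have hα' : αo = (1 - βo) * η := by rw [hα, EllShrink.alphaEll, ← hβ]
  have hβ0 : 0 ≤ βo := by rw [hβ']; exact div_nonneg (by linarith) hD.le
  have hβ1 : βo < 1 := by rw [hβ', div_lt_one hD]; linarith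
  have hα0 : 0 < αo := by rw [hα']; exact mul_pos (by linarith) hη0
  have htr : M.trace = p * η := by rw [hη, EllShrink.scale]; field_simp
  have htr2 : (M * M).trace = p * η ^ 2 * γ := by
    rw [hγ, EllShrink.sphericity, hη, EllShrink.scale]; field_simp
  have hf : ∀ q, EllShrink.rscmMSE Pr x M q = p * η ^ 2 * (A * (γ - 1) / ((γ - 1) + A)) +
      p * η ^ 2 * ((γ - 1) + A) * (q.2 - βo) ^ 2 + p * (q.1 - (1 - q.2) * η) ^ 2 := fun q => by
    rw [hP.rscmMSE_eq h4 hn hp hlaw hindep, ← hκ, htr, htr2]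
    have hn1 : (n : ℝ) - 1 ≠ 0 := by linarith
    have hn0' : (n : ℝ) ≠ 0 := by linarith
    have e1 : ((p * η) ^ 2 + p * η ^ 2 * γ) / ((n : ℝ) - 1) +
        κ * ((p * η) ^ 2 + 2 * (p * η ^ 2 * γ)) / n = p * η ^ 2 * A := by
      rw [hAdef]; field_simp; ring
    have hD' := hD.ne'
    have e2 : A * q.2 ^ 2 + (γ - 1) * (1 - q.2) ^ 2 =
        A * (γ - 1) / ((γ - 1) + A) + ((γ - 1) + A) * (q.2 - βo) ^ 2 := by
      rw [hβ']; field_simp; ring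
    rw [e1]
    linear_combination (p * η ^ 2) * e2
  have hK : 0 < p * η ^ 2 * ((γ - 1) + A) := by positivity
  refine ⟨hP.integrable_quadForm_sq h4, hP.integrable_frobSq_rscm_sub h4 hn0 hlaw,
    hden ▸ hD, hα0, hβ0, hβ1, EllShrink.argminOn_eq_singleton hK hp' hα' hf (Set.mem_univ _),
    EllShrink.argminOn_eq_singleton hK hp' hα' hf ⟨hα0.le, hβ0⟩, fun hne =>
    EllShrink.argminOn_eq_singleton hK hp' hα' hf ⟨hα0, ?_⟩⟩
  -- Strictness matters here: at γ = 1 the optimal β is 0, on the boundary of the open quadrant.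
  have : 1 < γ := lt_of_le_of_ne hγ1 (Ne.symm hne)
  change 0 < βo
  rw [hβ']
  exact div_pos (by linarith) hD
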